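/- Let $q$ be a prime power and $k$ a positive integer. A $k$-spread of a finite-dimensional $\mathbb{F}_q$-vector space $V$ is a set of $k$-dimensional subspaces of $V$ such that each nonzero vector of $V$ lies in exactly one of them, and a partial $k$-parallelism of $V$ is a set of pairwise disjoint $k$-spreads of $V$. Let $P(2k,k,q)$ denote the maximum size of a partial $k$-parallelism of a $2k$-dimensional vector space over $\mathbb{F}_q$. Put $N=\frac{q^{2k}-1}{q^k-1}$, let $[n]_j=n(n-1)\cdots(n-j+1)$, and let $$\begin{aligned}L={}&N^{2}q^{k^{2}}|\mathrm{GL}(k,q)|^{2}-\frac12\bigl(N(N-1)\bigr)^{2}|\mathrm{GL}(k,q)|^{2}+\frac1{3!}\bigl(N(N-1)(N-2)\bigr)^{2}|\mathrm{GL}(k,q)|\\&+\sum_{i=4}^{N}(-1)^{i+1}\frac1{i!}\bigl(N(N-1)(N-2)\bigr)^{2}\sum_{l\mid k}\Bigl(\bigl|\mathrm{GL}(k/l,q^{l})\bigr|-\Bigl|\bigcup_{\substack{l\mid m\mid k\\ m\neq l}}\mathrm{GL}(k/m,q^{m})\rtimes\mathrm{Gal}(\mathbb{F}_{q^m}/\mathbb{F}_q)\Bigr|\Bigr)\,l\,[q^{l}-2]_{i-3}.\end{aligned}$$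 Here $\mathrm{GL}(k/m,q^m)\rtimes\mathrm{Gal}(\mathbb{F}_{q^m}/\mathbb{F}_q)$ is regarded as a subgroup of $\mathrm{GL}(k,q)$, the group of bijective $\mathbb{F}_q$-linear maps $\mathbb{F}_{q^k}\to\mathbb{F}_{q^k}$: it consists of those $\varphi$ for which there is $\sigma\in\mathrm{Gal}(\mathbb{F}_{q^m}/\mathbb{F}_q)$ with $\varphi(vx)=\sigma(v)\varphi(x)$ for all $v\in\mathbb{F}_{q^m}$ and $x\in\mathbb{F}_{q^k}$. Then $L>0$ and $$P(2k,k,q)\ \ge\ \frac{|\mathrm{GL}(2k,q)|}{L}.$$ -/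

import Mathlib

noncomputable section

namespace PartialParallelism

/-- A `k`-spread of the `F`-space `V`: a set of `k`-dimensional subspaces such that each nonzero
vector lies in exactly one of them. -/
def IsSpread (F V : Type*) [Field F] [AddCommGroup V] [Module F V] (k : ℕ)
    (S : Set (Submodule F V)) : Prop :=
  (∀ U ∈ S, Module.finrank F U = k) ∧ ∀ v : V, v ≠ 0 → ∃! U : Submodule F V, U ∈ S ∧ v ∈ U

/-- A partial `k`-parallelism of `V`: a set of pairwise disjoint `k`-spreads
(disjoint as sets of subspaces). -/
def IsPartialParallelism (F V : Type*) [Field F] [AddCommGroup V] [Module F V] (k : ℕ)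
    (P : Set (Set (Submodule F V))) : Prop :=
  (∀ S ∈ P, IsSpread F V k S) ∧ P.Pairwise Disjoint

/-- The maximum size of a partial `k`-parallelism of `V`; this is `P(n, k, q)` for a space `V` of
dimension `n` over the field with `q` elements. (Over a finite space the set of sizes is nonempty
and bounded, so this supremum is a maximum.) -/
def maxPartialParallelism (F V : Type*) [Field F] [AddCommGroup V] [Module F V] (k : ℕ) : ℕ :=
  sSup {t : ℕ | ∃ P : Set (Set (Submodule F V)), IsPartialParallelism F V k P ∧ P.ncard = t}

/-- The subfield of `K` fixed by `x ↦ x ^ (q ^ m)`, where `q = |F|`. If `m` divides `[K : F]`, this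
is the unique intermediate field with `q ^ m` elements, i.e. `𝔽_{q^m}` inside `K`. -/
def subfieldOfDegree (F K : Type*) [Field F] [Fintype F] [Field K] [Algebra F K]
    [FiniteDimensional F K] (m : ℕ) : IntermediateField F K :=
  IntermediateField.fixedField
    (Subgroup.zpowers (FiniteField.frobeniusAlgEquivOfAlgebraic F K ^ m))

theorem mem_subfieldOfDegree (F K : Type*) [Field F] [Fintype F] [Field K] [Algebra F K]
    [FiniteDimensional F K] (m : ℕ) (x : K) :
    x ∈ subfieldOfDegree F K m ↔ x ^ (Fintype.card F ^ m) = x := by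
  have key : (FiniteField.frobeniusAlgEquivOfAlgebraic F K ^ m) x = x ^ (Fintype.card F ^ m) := by
    rw [AlgEquiv.coe_pow, FiniteField.coe_frobeniusAlgEquivOfAlgebraic_iterate]
  rw [subfieldOfDegree, IntermediateField.mem_fixedField_iff, ← key]
  constructor
  · intro h
    exact h _ (Subgroup.mem_zpowers _)
  · intro h f hf
    have hle : Subgroup.zpowers (FiniteField.frobeniusAlgEquivOfAlgebraic F K ^ m) ≤
        MulAction.stabilizer (K ≃ₐ[F] K) x := by
      rw [Subgroup.zpowers_le]
      exact h
    exact hle hf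

theorem finrank_subfieldOfDegree (F K : Type*) [Field F] [Fintype F] [Field K] [Algebra F K]
    [FiniteDimensional F K] (m : ℕ) (hm : m ∣ Module.finrank F K) :
    Module.finrank F (subfieldOfDegree F K m) = m := by
  have : Finite K := Module.finite_of_finite F
  have hpos : 0 < Module.finrank F K := Module.finrank_pos
  have h1 : Module.finrank (subfieldOfDegree F K m) K = Module.finrank F K / m := by
    rw [subfieldOfDegree, IntermediateField.finrank_fixedField_eq_card, Nat.card_zpowers,
      orderOf_pow, FiniteField.orderOf_frobeniusAlgEquivOfAlgebraic, Nat.gcd_eq_right hm]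
  have h2 := Module.finrank_mul_finrank F (subfieldOfDegree F K m) K
  rw [h1] at h2
  have h3 : 0 < Module.finrank F K / m :=
    Nat.div_pos (Nat.le_of_dvd hpos hm) (Nat.pos_of_dvd_of_pos hm hpos)
  exact Nat.eq_of_mul_eq_mul_right h3 (h2.trans (Nat.mul_div_cancel' hm).symm)

/-- The group of `E`-semilinear bijections of `K` whose companion automorphism of `E` lies in
`Gal(E/F)`, as a subgroup of the group of `F`-linear bijections of `K`. For `|F| = q`,
`[K : F] = k` and `[E : F] = m` it is `GL(k/m, q^m) ⋊ Gal(𝔽_{q^m}/𝔽_q)`, as a subgroup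
of `GL(k, q)`. -/
def semilinearGroup (F K : Type*) [Field F] [Field K] [Algebra F K] (E : IntermediateField F K) :
    Subgroup (K ≃ₗ[F] K) where
  carrier := {φ | ∃ σ : E ≃ₐ[F] E, ∀ (v : E) (x : K), φ ((v : K) * x) = (σ v : K) * φ x}
  mul_mem' := by
    rintro φ ψ ⟨σ, hσ⟩ ⟨τ, hτ⟩
    refine ⟨σ * τ, fun v x => ?_⟩
    simp only [LinearEquiv.mul_apply, AlgEquiv.mul_apply]
    rw [hτ, hσ]
  one_mem' := ⟨1, fun _ _ => rfl⟩
  inv_mem' := by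
    rintro φ ⟨σ, hσ⟩
    refine ⟨σ⁻¹, fun v x => φ.injective ?_⟩
    have h1 : ∀ y, φ (φ⁻¹ y) = y := fun y => φ.apply_symm_apply y
    have h2 : σ (σ⁻¹ v) = v := σ.apply_symm_apply v
    rw [h1, hσ, h1, h2]

/-- The order of `GL(d, F)`. -/
def cardGL (d : ℕ) (F : Type*) [Field F] : ℕ := Nat.card (GL (Fin d) F)

/-- The size of the union of the groups `GL(k/m, q^m) ⋊ Gal(𝔽_{q^m}/𝔽_q)`, as subgroups of
`GL(k, q)`, over the divisors `m` of `k` such that `l ∣ m` and `m ≠ l`. -/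
def unionCard (F K : Type*) [Field F] [Fintype F] [Field K] [Algebra F K]
    [FiniteDimensional F K] (k l : ℕ) : ℕ :=
  Set.ncard (⋃ m ∈ {m : ℕ | m ∣ k ∧ l ∣ m ∧ m ≠ l},
    (semilinearGroup F K (subfieldOfDegree F K m) : Set (K ≃ₗ[F] K)))

/-- The size `N = (q^{2k} - 1) / (q^k - 1)` of a `k`-spread in dimension `2k`
(the division is exact). -/
def spreadSize (q k : ℕ) : ℕ := (q ^ (2 * k) - 1) / (q ^ k - 1)

/-- The number `L`, for `|F| = q` and `[K : F] = k`. Here `Nat.descFactorial n j` is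
`n (n - 1) ⋯ (n - j + 1)`. -/
def L (F K : Type*) [Field F] [Fintype F] [Field K] [Algebra F K] [FiniteDimensional F K]
    (q k : ℕ) : ℚ :=
  let N : ℚ := spreadSize q k
  N ^ 2 * (q : ℚ) ^ (k ^ 2) * (cardGL k F : ℚ) ^ 2
    - 1 / 2 * (N * (N - 1)) ^ 2 * (cardGL k F : ℚ) ^ 2
    + 1 / (Nat.factorial 3 : ℚ) * (N * (N - 1) * (N - 2)) ^ 2 * (cardGL k F : ℚ)
    + ∑ i ∈ Finset.Icc 4 (spreadSize q k),
        (-1 : ℚ) ^ (i + 1) * (1 / (Nat.factorial i : ℚ)) * (N * (N - 1) * (N - 2)) ^ 2 *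
          ∑ l ∈ Nat.divisors k,
            ((cardGL (k / l) (subfieldOfDegree F K l) : ℚ) - (unionCard F K k l : ℚ)) * (l : ℚ) *
              (Nat.descFactorial (q ^ l - 2) (i - 3) : ℚ)

end PartialParallelism

end

/-! Let `D` be the Desarguesian spread of `K × K`, that is, the points of the projective line over
`K` viewed as `F`-subspaces, and let `G` be the `F`-linear group of `K × K`. Take a largest family
of elements of `G` whose translates of `D` are pairwise disjoint. By maximality every `φ` has a
translate meeting some `ψ D` of the family, so `ψ⁻¹ φ` lies in the set `B` of elements moving `D` to
a spread that meets `D`. Hence `|G|` is at most `|B|` times the size of the family, and it remains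
to show `|B| ≤ L`.

For `φ` in `G` let `s` be the number of points of `D` sent into `D`. Inclusion-exclusion writes the
indicator of `s ≥ 1` as an alternating sum of binomials in `s`. Summed over `G`, these count matched
pairs of tuples. Since `GL(2, K)` is 3-transitive on the line, the sums reduce to elements fixing
one, two or three chosen points (`sum_descFactorial_hitCount`). Fixing `∞, 0, 1` leaves only the
maps `g × g`, for which `s = q ^ l + 1`, where `l` is the degree of the intertwining field of `g`
(`hitCount_skewProd_self`).

The `g` with field of degree exactly `l` number `l |GL(k/l, q^l)|` minus the size of the union over
proper multiples of `l`. In `L` the factor `l` also multiplies the union. That only increases the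
value, because the tail coefficients are nonpositive (`tailCoeff_nonpos`). -/

noncomputable section

namespace PartialParallelism

/-! ### Double counting of matched tuples and inclusion-exclusion -/

section Counting

open Finset

/-- The number of points of `X` which `φ` maps to a point of `X`, for an embedding `j` of `X`
into a `G`-set. -/
def hitCount {G X Y : Type*} [Group G] [MulAction G Y] (j : X → Y) (φ : G) : ℕ :=
  Nat.card {a : X // ∃ b, φ • j a = j b}

variable {G H X Y : Type*} [Group G] [Group H] [MulAction G Y] [MulAction H X]
  {j : X → Y} (ι : H →* G)

/-- The image of `H` permutes `j(X)`, so translating by it on either side only relabels the matched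
points. -/
theorem hitCount_mul (hj : ∀ (h : H) x, j (h • x) = ι h • j x) (h h' : H) (φ : G) :
    hitCount j (ι h * φ * ι h') = hitCount j φ := by
  refine Nat.card_congr ((MulAction.toPerm h').subtypeEquiv fun a => ?_)
  simp only [MulAction.toPerm_apply, hj, mul_smul]
  constructor
  · rintro ⟨b, hb⟩
    exact ⟨h⁻¹ • b, by rw [hj, ← hb, map_inv, inv_smul_smul]⟩
  · rintro ⟨b, hb⟩
    exact ⟨h • b, by rw [hj, ← hb]⟩

theorem hitCount_le [Finite X] (φ : G) : hitCount j φ ≤ Nat.card X :=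
  Nat.card_le_card_of_injective _ Subtype.val_injective

/-- The `n`-tuples of distinct points of `X` mapped into `X` by `φ`, together with their images. -/
def tupleEquiv (hinj : Function.Injective j) (n : ℕ) (φ : G) :
    (Fin n ↪ {a : X // ∃ b, φ • j a = j b}) ≃
      {p : (Fin n ↪ X) × (Fin n ↪ X) // ∀ i, φ • j (p.1 i) = j (p.2 i)} where
  toFun e := ⟨⟨e.trans (Function.Embedding.subtype _),
    ⟨fun i => (e i).2.choose, fun i i' h => e.injective <| Subtype.ext <| hinj <|
      MulAction.injective φ <| by
        change φ • j _ = φ • j _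
        rw [(e i).2.choose_spec, (e i').2.choose_spec]; exact congrArg j h⟩⟩,
    fun i => (e i).2.choose_spec⟩
  invFun p := ⟨fun i => ⟨p.1.1 i, p.1.2 i, p.2 i⟩,
    fun i i' h => p.1.1.injective (congrArg Subtype.val h)⟩
  left_inv e := by ext i; rfl
  right_inv p := by
    refine Subtype.ext (Prod.ext (by ext i; rfl) ?_)
    ext i
    refine hinj ?_
    have h1 := p.2 i
    rw [← h1]
    exact ((⟨_, h1⟩ : ∃ b, φ • j (p.1.1 i) = j b).choose_spec).symm

theorem descFactorial_hitCount [Fintype X] [DecidableEq Y] (hinj : Function.Injective j) (n : ℕ)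
    (φ : G) :
    (hitCount j φ).descFactorial n =
      #{p : (Fin n ↪ X) × (Fin n ↪ X) | ∀ i, φ • j (p.1 i) = j (p.2 i)} := by
  classical
  rw [← Fintype.card_subtype, ← Fintype.card_congr (tupleEquiv hinj n φ),
    Fintype.card_embedding_eq, Fintype.card_fin, hitCount, Nat.card_eq_fintype_card]

/-- Counting pairs of `n`-tuples matched by group elements, when a subgroup is `n`-transitive. -/
theorem sum_descFactorial_hitCount [Fintype G] [Fintype X] [DecidableEq Y]
    (hinj : Function.Injective j)
    (hj : ∀ (h : H) x, j (h • x) = ι h • j x) (n : ℕ)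
    (htrans : MulAction.IsMultiplyPretransitive H X n) (a₀ : Fin n ↪ X) (f : ℕ → ℚ) :
    ∑ φ : G, ((hitCount j φ).descFactorial n : ℚ) * f (hitCount j φ) =
      ((Fintype.card X).descFactorial n : ℚ) ^ 2 *
        ∑ φ : G with ∀ i, φ • j (a₀ i) = j (a₀ i), f (hitCount j φ) := by
  classical
  have key : ∀ p : (Fin n ↪ X) × (Fin n ↪ X),
      ∑ φ : G with ∀ i, φ • j (p.1 i) = j (p.2 i), f (hitCount j φ) =
        ∑ φ : G with ∀ i, φ • j (a₀ i) = j (a₀ i), f (hitCount j φ) := by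
    rintro ⟨a, b⟩
    obtain ⟨h, rfl⟩ := htrans.exists_smul_eq a₀ a
    obtain ⟨h', rfl⟩ := htrans.exists_smul_eq a₀ b
    symm
    -- Two-sided translation moves the matching of `a₀` with itself to that of `a` with `b`;
    -- `hitCount_mul` keeps the weight unchanged.
    refine Finset.sum_bij' (fun φ _ => ι h' * φ * ι h⁻¹) (fun φ _ => ι h'⁻¹ * φ * ι h)
      ?_ ?_ ?_ ?_ ?_
    · intro φ hφ
      simp only [mem_filter, mem_univ, true_and] at hφ ⊢
      intro i
      simp [hj, mul_smul, hφ i]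
    · intro φ hφ
      simp only [mem_filter, mem_univ, true_and] at hφ ⊢
      intro i
      have := hφ i
      simp only [Function.Embedding.smul_apply, hj] at this
      simp [mul_smul, this]
    · intro φ _; simp [mul_assoc]
    · intro φ _; simp [mul_assoc]
    · intro φ _; rw [hitCount_mul ι hj]
  calc _ = ∑ φ : G, ∑ p : (Fin n ↪ X) × (Fin n ↪ X),
        if ∀ i, φ • j (p.1 i) = j (p.2 i) then f (hitCount j φ) else 0 := by
        refine Finset.sum_congr rfl fun φ _ => ?_
        rw [descFactorial_hitCount hinj, ← Finset.sum_filter, Finset.sum_const, nsmul_eq_mul]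
    _ = ∑ p : (Fin n ↪ X) × (Fin n ↪ X),
        ∑ φ : G with ∀ i, φ • j (a₀ i) = j (a₀ i), f (hitCount j φ) := by
        rw [Finset.sum_comm]
        refine Finset.sum_congr rfl fun p _ => ?_
        rw [← key p, Finset.sum_filter]
    _ = _ := by
        rw [Finset.sum_const, Finset.card_univ, Fintype.card_prod, Fintype.card_embedding_eq,
          Fintype.card_fin, nsmul_eq_mul]
        push_cast
        ring

/-- The contribution of the terms of index at least `4`, divided by `s (s - 1) (s - 2)`, to the
inclusion-exclusion formula for a set of `s` matched pairs. -/
def tailCoeff (N s : ℕ) : ℚ :=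
  ∑ i ∈ Icc 4 N, (-1 : ℚ) ^ (i + 1) * (1 / (Nat.factorial i : ℚ)) *
    (Nat.descFactorial (s - 3) (i - 3) : ℚ)

theorem descFactorial_three_mul (s i : ℕ) (hi : 3 ≤ i) :
    s.descFactorial 3 * (s - 3).descFactorial (i - 3) = s.descFactorial i := by
  obtain ⟨i, rfl⟩ := Nat.exists_eq_add_of_le hi
  rw [Nat.add_sub_cancel_left, add_comm 3 i]
  have := Nat.descFactorial_mul_descFactorial (n := s) (k := 3) (m := i + 3) (by omega)
  rw [Nat.add_sub_cancel] at this
  rw [← this, mul_comm]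

/-- This is the vanishing of the alternating sum of `s.choose m` for `s ≥ 1`. Terms of index at
least 3 all contain `s.descFactorial 3`, which is split off so that 3-transitivity suffices for the
whole tail. Indices between `s` and `N` contribute zero, which makes the range independent of `s`.
-/
theorem inclusion_exclusion (N s : ℕ) (h1 : 1 ≤ s) (hs : s ≤ N) (hN : 3 ≤ N) :
    (s : ℚ) - 1 / 2 * (s.descFactorial 2 : ℚ) + 1 / (Nat.factorial 3 : ℚ) * (s.descFactorial 3 : ℚ)
      + (s.descFactorial 3 : ℚ) * tailCoeff N s = 1 := by
  have h := Int.alternating_sum_range_choose_of_ne (n := s) (by omega)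
  have h' : ∑ m ∈ range (N + 1), (-1 : ℚ) ^ m * (s.choose m : ℚ) = 0 := by
    rw [← Finset.sum_subset (s₁ := range (s + 1))]
    · exact_mod_cast h
    · intro i hi; simp only [mem_range] at *; omega
    · intro i _ hi
      rw [Nat.choose_eq_zero_of_lt (by simpa using hi)]; simp
  have hd : ∀ m, (s.choose m : ℚ) = 1 / (m.factorial : ℚ) * (s.descFactorial m : ℚ) := by
    intro m
    have := Nat.descFactorial_eq_factorial_mul_choose s m
    have h0 : (m.factorial : ℚ) ≠ 0 := by exact_mod_cast m.factorial_ne_zero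
    rw [this]; push_cast; field_simp
  have hsplit : ∑ m ∈ range (N + 1), (-1 : ℚ) ^ m * (s.choose m : ℚ) =
      ∑ m ∈ range 4, (-1 : ℚ) ^ m * (s.choose m : ℚ) +
        ∑ m ∈ Icc 4 N, (-1 : ℚ) ^ m * (s.choose m : ℚ) := by
    rw [← Finset.sum_range_add_sum_Ico _ (show 4 ≤ N + 1 by omega)]
    -- `Ico 4 (N + 1)` and `Icc 4 N` agree definitionally.
    rfl
  have htail : (s.descFactorial 3 : ℚ) * tailCoeff N s =
      - ∑ m ∈ Icc 4 N, (-1 : ℚ) ^ m * (s.choose m : ℚ) := by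
    rw [tailCoeff, Finset.mul_sum, ← Finset.sum_neg_distrib]
    refine Finset.sum_congr rfl fun i hi => ?_
    rw [hd, ← descFactorial_three_mul s i (by simp only [mem_Icc] at hi; omega)]
    push_cast
    ring
  rw [htail]
  rw [hsplit] at h'
  generalize ∑ m ∈ Icc 4 N, (-1 : ℚ) ^ m * (s.choose m : ℚ) = T at h' ⊢
  simp only [Finset.sum_range_succ, Finset.sum_range_zero, hd] at h'
  norm_num [Nat.factorial] at h' ⊢
  linarith

/-- Solving `inclusion_exclusion` for the tail gives `-(s - 1).choose 3`, divided by the positive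
number `s (s - 1) (s - 2)`. -/
theorem tailCoeff_nonpos (N s : ℕ) (h3 : 3 ≤ s) (hs : s ≤ N) : tailCoeff N s ≤ 0 := by
  have h := inclusion_exclusion N s (by omega) hs (by omega)
  obtain ⟨t, rfl⟩ := Nat.exists_eq_add_of_le h3
  have e2 : ((3 + t).descFactorial 2 : ℚ) = (3 + t) * (2 + t) := by
    rw [show 3 + t = t + 3 by ring]
    simp [Nat.descFactorial_succ]; ring
  have e3 : ((3 + t).descFactorial 3 : ℚ) = (3 + t) * (2 + t) * (1 + t) := by
    rw [show 3 + t = t + 3 by ring]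
    simp [Nat.descFactorial_succ]; ring
  rw [e2, e3] at h
  norm_num [Nat.factorial] at h
  have hp : (0 : ℚ) < (3 + t) * (2 + t) * (1 + t) := by positivity
  have : (3 + t : ℚ) * (2 + t) * (1 + t) * tailCoeff N (3 + t) = - ((2 + t) * (1 + t) * t / 6) := by
    linear_combination h
  by_contra! hc
  have h1 := mul_pos hp hc
  have h2 : (0 : ℚ) ≤ (2 + t) * (1 + t) * t / 6 := by positivity
  linarith

end Counting

/-! ### The projective line and the Desarguesian spread -/

section ProjectiveLine

open scoped LinearAlgebra.Projectivization Pointwise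
open Projectivization

/-- Representatives of the first two points are rescaled by the coordinates of a representative of
the third. Both coordinates are nonzero because the third point differs from the other two. -/
theorem exists_basis_of_embedding_three {K V : Type*} [Field K] [AddCommGroup V] [Module K V]
    (hV : Module.finrank K V = 2) (a : Fin 3 ↪ ℙ K V) :
    ∃ b' : Module.Basis (Fin 2) K V, a 0 = mk K (b' 0) (b'.ne_zero 0) ∧
      a 1 = mk K (b' 1) (b'.ne_zero 1) ∧
      ∃ h, a 2 = mk K (b' 0 + b' 1) h := by
  have h01 : a 0 ≠ a 1 := fun h => by simpa using a.injective h
  have h02 : a 0 ≠ a 2 := fun h => by simpa using a.injective h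
  have h12 : a 1 ≠ a 2 := fun h => by simpa using a.injective h
  have hli := linearIndependent_pair_iff_ne.2 h01
  let b₁ : Module.Basis (Fin 2) K V :=
    basisOfLinearIndependentOfCardEqFinrank hli (by simp [hV])
  have hb0 : b₁ 0 = (a 0).rep := by simp [b₁]
  have hb1 : b₁ 1 = (a 1).rep := by simp [b₁]
  have hsum : (a 2).rep = b₁.repr (a 2).rep 0 • b₁ 0 + b₁.repr (a 2).rep 1 • b₁ 1 := by
    conv_lhs => rw [← b₁.sum_repr (a 2).rep]
    rw [Fin.sum_univ_two]
  set c := b₁.repr (a 2).rep with hc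
  have hc0 : c 0 ≠ 0 := by
    intro h0
    rw [h0, zero_smul, zero_add, hb1] at hsum
    apply h12
    rw [← mk_rep (a 1), ← mk_rep (a 2), eq_comm, mk_eq_mk_iff']
    exact ⟨_, hsum.symm⟩
  have hc1 : c 1 ≠ 0 := by
    intro h0
    rw [h0, zero_smul, add_zero, hb0] at hsum
    apply h02
    rw [← mk_rep (a 0), ← mk_rep (a 2), eq_comm, mk_eq_mk_iff']
    exact ⟨_, hsum.symm⟩
  refine ⟨b₁.unitsSMul ![Units.mk0 _ hc0, Units.mk0 _ hc1], ?_, ?_, ?_⟩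
  · conv_lhs => rw [← mk_rep (a 0)]
    rw [eq_comm, mk_eq_mk_iff']
    exact ⟨c 0, by simp [Module.Basis.unitsSMul_apply, hb0, Units.smul_def]⟩
  · conv_lhs => rw [← mk_rep (a 1)]
    rw [eq_comm, mk_eq_mk_iff']
    exact ⟨c 1, by simp [Module.Basis.unitsSMul_apply, hb1, Units.smul_def]⟩
  · have e : (b₁.unitsSMul ![Units.mk0 _ hc0, Units.mk0 _ hc1]) 0 +
        (b₁.unitsSMul ![Units.mk0 _ hc0, Units.mk0 _ hc1]) 1 = (a 2).rep := by
      rw [hsum]; simp [Module.Basis.unitsSMul_apply, Units.smul_def]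
    have h : (b₁.unitsSMul ![Units.mk0 _ hc0, Units.mk0 _ hc1]) 0 +
        (b₁.unitsSMul ![Units.mk0 _ hc0, Units.mk0 _ hc1]) 1 ≠ 0 := by
      rw [e]; exact (a 2).rep_nonzero
    refine ⟨h, ?_⟩
    conv_lhs => rw [← mk_rep (a 2)]
    congr 1
    exact e.symm

/-- The linear group of a plane is `3`-transitive on the projective line. -/
theorem isMultiplyPretransitive_three {K V : Type*} [Field K] [AddCommGroup V] [Module K V]
    (hV : Module.finrank K V = 2) :
    MulAction.IsMultiplyPretransitive (V ≃ₗ[K] V) (ℙ K V) 3 := by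
  rw [MulAction.isMultiplyPretransitive_iff]
  intro x y
  obtain ⟨b₁, h0, h1, h, h2⟩ := exists_basis_of_embedding_three hV x
  obtain ⟨b₂, h0', h1', h', h2'⟩ := exists_basis_of_embedding_three hV y
  refine ⟨b₁.equiv b₂ (Equiv.refl _), ?_⟩
  ext i
  fin_cases i
  · simp [h0, h0', smul_mk]
  · simp [h1, h1', smul_mk]
  · simp [h2, h2', smul_mk]

variable (F K : Type*) [Field F] [Field K] [Algebra F K]

/-- The points of the Desarguesian spread of `K × K`, as subspaces over `F`. -/
def spreadElement (p : ℙ K (K × K)) : Submodule F (K × K) := p.submodule.restrictScalars F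

theorem spreadElement_injective : Function.Injective (spreadElement F K) :=
  (Submodule.restrictScalars_injective F K (K × K)).comp submodule_injective

/-- Restriction of scalars, as a homomorphism of linear groups. -/
def restrictScalarsHom : ((K × K) ≃ₗ[K] (K × K)) →* ((K × K) ≃ₗ[F] (K × K)) where
  toFun f := f.restrictScalars F
  map_one' := rfl
  map_mul' _ _ := rfl

variable {F K}

theorem mem_spreadElement_mk {v w : K × K} (hv : v ≠ 0) :
    w ∈ spreadElement F K (mk K v hv) ↔ ∃ c : K, c • v = w := by
  rw [spreadElement, Submodule.restrictScalars_mem, submodule_mk, Submodule.mem_span_singleton]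

theorem mem_spreadElement_iff {p : ℙ K (K × K)} {v : K × K} (hv : v ≠ 0) :
    v ∈ spreadElement F K p ↔ mk K v hv = p := by
  induction p using ind with | h w hw =>
  rw [mem_spreadElement_mk, mk_eq_mk_iff']

theorem spreadElement_smul (h : (K × K) ≃ₗ[K] (K × K)) (p : ℙ K (K × K)) :
    spreadElement F K (h • p) = restrictScalarsHom F K h • spreadElement F K p := by
  induction p using ind with | h w hw =>
  ext v
  rw [smul_mk, mem_spreadElement_mk, Submodule.mem_smul_pointwise_iff_exists]
  constructor
  · rintro ⟨c, rfl⟩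
    exact ⟨c • w, (mem_spreadElement_mk hw).2 ⟨c, rfl⟩, h.map_smul c w⟩
  · rintro ⟨x, hx, rfl⟩
    obtain ⟨c, rfl⟩ := (mem_spreadElement_mk hw).1 hx
    exact ⟨c, (h.map_smul c w).symm⟩

variable [FiniteDimensional F K]

theorem finrank_spreadElement (p : ℙ K (K × K)) :
    Module.finrank F (spreadElement F K p) = Module.finrank F K := by
  have h := Module.finrank_mul_finrank F K p.submodule
  rw [finrank_submodule, mul_one] at h
  exact h.symm

/-- Both sides have dimension `[K : F]` over `F`, so inclusion already forces equality. -/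
theorem smul_spreadElement_eq_iff {v w : K × K} (hv : v ≠ 0) (hw : w ≠ 0)
    (φ : (K × K) ≃ₗ[F] (K × K)) :
    φ • spreadElement F K (mk K v hv) = spreadElement F K (mk K w hw) ↔
      ∀ c : K, ∃ d : K, φ (c • v) = d • w := by
  constructor
  · intro h c
    have : φ (c • v) ∈ φ • spreadElement F K (mk K v hv) :=
      Submodule.smul_mem_pointwise_smul _ φ _ ((mem_spreadElement_mk hv).2 ⟨c, rfl⟩)
    rw [h, mem_spreadElement_mk] at this
    obtain ⟨d, hd⟩ := this
    exact ⟨d, hd.symm⟩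
  · intro h
    refine Submodule.eq_of_le_of_finrank_eq ?_ ?_
    · intro x hx
      obtain ⟨y, hy, rfl⟩ := (Submodule.mem_smul_pointwise_iff_exists _ _ _).1 hx
      obtain ⟨c, rfl⟩ := (mem_spreadElement_mk hv).1 hy
      obtain ⟨d, hd⟩ := h c
      exact (mem_spreadElement_mk hw).2 ⟨d, hd.symm⟩
    · rw [finrank_spreadElement]
      rw [← finrank_spreadElement (F := F) (mk K v hv)]
      exact LinearEquiv.finrank_map_eq φ _

theorem isSpread_spreadElement :
    IsSpread F (K × K) (Module.finrank F K) (Set.range (spreadElement F K)) := by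
  constructor
  · rintro _ ⟨p, rfl⟩
    exact finrank_spreadElement p
  · intro v hv
    refine ⟨spreadElement F K (mk K v hv), ⟨⟨_, rfl⟩, (mem_spreadElement_iff hv).2 rfl⟩, ?_⟩
    rintro _ ⟨⟨p, rfl⟩, hp⟩
    rw [(mem_spreadElement_iff hv).1 hp]

end ProjectiveLine

/-! ### Stabilizers of one, two and three points -/

section Stabilizer

open scoped LinearAlgebra.Projectivization Pointwise
open Projectivization

variable {F K : Type*} [Field F] [Field K] [Algebra F K]

/-- The points `∞`, `0` and `1` of the projective line. -/
def baseTriple (K : Type*) [Field K] : Fin 3 ↪ ℙ K (K × K) where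
  toFun := ![mk K (0, 1) (by simp), mk K (1, 0) (by simp), mk K (1, 1) (by simp)]
  inj' := by
    intro i i' h
    fin_cases i <;> fin_cases i' <;> first | rfl | (simp [mk_eq_mk_iff'] at h)

/-- The maps `x ↦ g (a x)` for `a` in this field are the maps `b g`, with `b` in `K`. -/
def intertwiningField (g : K ≃ₗ[F] K) : IntermediateField F K where
  carrier := {a | ∃ b, ∀ x, g (a * x) = b * g x}
  mul_mem' := by
    rintro a a' ⟨b, hb⟩ ⟨b', hb'⟩
    exact ⟨b * b', fun x => by rw [mul_assoc, hb, hb', mul_assoc]⟩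
  add_mem' := by
    rintro a a' ⟨b, hb⟩ ⟨b', hb'⟩
    exact ⟨b + b', fun x => by rw [add_mul, map_add, hb, hb', add_mul]⟩
  algebraMap_mem' r := ⟨algebraMap F K r, fun x => by
    rw [← Algebra.smul_def, map_smul, Algebra.smul_def]⟩
  inv_mem' := by
    rintro a ⟨b, hb⟩
    rcases eq_or_ne a 0 with rfl | ha
    · exact ⟨0, fun x => by simp⟩
    · have hb0 : b ≠ 0 := by
        rintro rfl
        have := hb (a⁻¹)
        simp [ha] at this
      refine ⟨b⁻¹, fun x => ?_⟩
      have := hb (a⁻¹ * x)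
      rw [mul_inv_cancel_left₀ ha] at this
      rw [this, inv_mul_cancel_left₀ hb0]

variable [FiniteDimensional F K]

/-- A block triangular automorphism has invertible diagonal blocks; finite dimension reduces this to
injectivity. -/
theorem exists_eq_skewProd {M N : Type*} [AddCommGroup M] [AddCommGroup N] [Module F M]
    [Module F N] [FiniteDimensional F M] [FiniteDimensional F N]
    (φ : (M × N) ≃ₗ[F] (M × N)) (h : ∀ y, (φ (0, y)).1 = 0) :
    ∃ (g : M ≃ₗ[F] M) (g' : N ≃ₗ[F] N) (c : M →ₗ[F] N), φ = g.skewProd g' c := by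
  let g₀ : M →ₗ[F] M := LinearMap.fst F M N ∘ₗ φ.toLinearMap ∘ₗ LinearMap.inl F M N
  let h₀ : N →ₗ[F] N := LinearMap.snd F M N ∘ₗ φ.toLinearMap ∘ₗ LinearMap.inr F M N
  let c : M →ₗ[F] N := LinearMap.snd F M N ∘ₗ φ.toLinearMap ∘ₗ LinearMap.inl F M N
  have hh : Function.Injective h₀ := by
    rw [injective_iff_map_eq_zero]
    intro y hy
    have : φ (0, y) = 0 := Prod.ext (h y) hy
    simpa using this
  have hg : Function.Injective g₀ := by
    rw [injective_iff_map_eq_zero]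
    intro x hx
    -- If the first component of `φ (x, 0)` vanishes, then `φ (x, 0)` is some `φ (0, y)`, so `x =
    -- 0`.
    obtain ⟨y, hy⟩ := LinearMap.surjective_of_injective hh (φ (x, 0)).2
    have : φ (0, y) = φ (x, 0) := Prod.ext ((h y).trans hx.symm) hy
    have := φ.injective this
    exact (congrArg Prod.fst this).symm
  refine ⟨LinearEquiv.ofInjectiveEndo g₀ hg, LinearEquiv.ofInjectiveEndo h₀ hh, c, ?_⟩
  ext ⟨x, y⟩
  · have : φ (x, y) = φ (x, 0) + φ (0, y) := by rw [← map_add]; simp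
    rw [this]
    simp [h, g₀]
  · have : φ (x, y) = φ (x, 0) + φ (0, y) := by rw [← map_add]; simp
    rw [this]
    simp [h₀, c, add_comm]

theorem skewProd_inj {M N : Type*} [AddCommGroup M] [AddCommGroup N] [Module F M]
    [Module F N] {g₁ g₂ : M ≃ₗ[F] M} {h₁ h₂ : N ≃ₗ[F] N} {c₁ c₂ : M →ₗ[F] N}
    (h : g₁.skewProd h₁ c₁ = g₂.skewProd h₂ c₂) : g₁ = g₂ ∧ h₁ = h₂ ∧ c₁ = c₂ := by
  have key := fun x y => congrArg (fun e : (M × N) ≃ₗ[F] (M × N) => e (x, y)) h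
  simp only [LinearEquiv.skewProd_apply, Prod.mk.injEq] at key
  refine ⟨?_, ?_, ?_⟩
  · ext x; exact (key x 0).1
  · ext y; simpa using (key 0 y).2
  · ext x; simpa using (key x 0).2

theorem smul_baseTriple_zero_iff (φ : (K × K) ≃ₗ[F] (K × K)) :
    φ • spreadElement F K (baseTriple K 0) = spreadElement F K (baseTriple K 0) ↔
      ∀ y, (φ (0, y)).1 = 0 := by
  refine (smul_spreadElement_eq_iff _ _ φ).trans (forall_congr' fun c => ?_)
  simp [Prod.ext_iff]

theorem smul_baseTriple_one_iff (φ : (K × K) ≃ₗ[F] (K × K)) :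
    φ • spreadElement F K (baseTriple K 1) = spreadElement F K (baseTriple K 1) ↔
      ∀ x, (φ (x, 0)).2 = 0 := by
  refine (smul_spreadElement_eq_iff _ _ φ).trans (forall_congr' fun c => ?_)
  simp [Prod.ext_iff]

theorem smul_baseTriple_two_iff (φ : (K × K) ≃ₗ[F] (K × K)) :
    φ • spreadElement F K (baseTriple K 2) = spreadElement F K (baseTriple K 2) ↔
      ∀ x, (φ (x, x)).1 = (φ (x, x)).2 := by
  refine (smul_spreadElement_eq_iff _ _ φ).trans (forall_congr' fun c => ?_)
  simp [Prod.ext_iff, eq_comm]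

/-- The point `∞` is always matched and accounts for the `+ 1`. The line of slope `a` goes to the
line of slope `b` exactly when `g (a x) = b g x` for all `x`, so the matched finite slopes form the
intertwining field. -/
theorem hitCount_skewProd_self [Finite K] (g : K ≃ₗ[F] K) :
    hitCount (spreadElement F K) (g.skewProd g 0 : (K × K) ≃ₗ[F] (K × K)) =
      Nat.card (intertwiningField g) + 1 := by
  rw [hitCount, ← Finite.card_option]
  symm
  have h1a : ∀ a : K, ((1, a) : K × K) ≠ 0 := fun a => by simp
  refine Nat.card_eq_of_bijective (fun o : Option (intertwiningField g) =>
    (o.elim ⟨baseTriple K 0, baseTriple K 0, (smul_baseTriple_zero_iff _).2 fun y => by simp⟩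
      fun a => ⟨mk K (1, a.1) (h1a a.1), mk K (1, a.2.choose) (h1a _),
        (smul_spreadElement_eq_iff _ _ _).2 fun c => ⟨g c, by
          have := a.2.choose_spec c
          ext
          · simp
          · simpa [mul_comm c] using this.trans (mul_comm _ _)⟩⟩ :
      {p : ℙ K (K × K) // ∃ p', (g.skewProd g 0 : (K × K) ≃ₗ[F] (K × K)) • spreadElement F K p =
        spreadElement F K p'})) ⟨?_, ?_⟩
  · rintro (_ | a) (_ | a') h
    · rfl
    · have : mk K ((0, 1) : K × K) (by simp) = mk K (1, a'.1) (h1a _) := congrArg Subtype.val h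
      rw [mk_eq_mk_iff'] at this
      simp at this
    · have : mk K (1, a.1) (h1a _) = mk K ((0, 1) : K × K) (by simp) := congrArg Subtype.val h
      rw [mk_eq_mk_iff'] at this
      simp at this
    · have := congrArg Subtype.val h
      simp [mk_eq_mk_iff'] at this
      simp [this]
  · rintro ⟨p, p', h⟩
    induction p using ind with | h v hv =>
    induction p' using ind with | h w hw =>
    by_cases hv0 : v.1 = 0
    · refine ⟨none, Subtype.ext ?_⟩
      have hv2 : v.2 ≠ 0 := fun h2 => hv (Prod.ext hv0 h2)
      change mk K ((0, 1) : K × K) (by simp) = mk K v hv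
      rw [mk_eq_mk_iff']
      exact ⟨v.2⁻¹, by simp [Prod.ext_iff, hv0, hv2]⟩
    · have hmk : mk K v hv = mk K (1, v.1⁻¹ * v.2) (h1a _) := by
        rw [mk_eq_mk_iff']
        exact ⟨v.1, by simp [hv0]⟩
      have h' := h
      rw [hmk, smul_spreadElement_eq_iff] at h'
      -- The image of `(1, v.1⁻¹ * v.2)` has first component `g 1 ≠ 0`, so the image line is not
      -- `∞`.
      have hw1 : w.1 ≠ 0 := by
        intro hw1
        obtain ⟨d, hd⟩ := h' 1
        have := congrArg Prod.fst hd
        simp [hw1] at this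
      have hmem : v.1⁻¹ * v.2 ∈ intertwiningField g := by
        refine ⟨w.1⁻¹ * w.2, fun x => ?_⟩
        obtain ⟨d, hd⟩ := h' x
        have e1 := congrArg Prod.fst hd
        have e2 := congrArg Prod.snd hd
        simp only [LinearEquiv.skewProd_apply, Prod.smul_mk, smul_eq_mul, mul_one,
          LinearMap.zero_apply, add_zero, Prod.smul_fst, Prod.smul_snd] at e1 e2
        rw [mul_comm _ x, e2, e1]
        field_simp
      exact ⟨some ⟨_, hmem⟩, Subtype.ext hmk.symm⟩

open Finset

variable [Fintype ((K × K) ≃ₗ[F] (K × K))] [Fintype (K ≃ₗ[F] K)]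
  [DecidableEq (Submodule F (K × K))]

theorem card_stabilizer_one [Fintype (K →ₗ[F] K)] :
    #{φ : (K × K) ≃ₗ[F] (K × K) | ∀ i : Fin 1,
      φ • spreadElement F K ((Fin.castLEEmb (by decide : 1 ≤ 3)).trans (baseTriple K) i) =
        spreadElement F K ((Fin.castLEEmb (by decide : 1 ≤ 3)).trans (baseTriple K) i)} =
      Fintype.card (K ≃ₗ[F] K) ^ 2 * Fintype.card (K →ₗ[F] K) := by
  rw [sq, ← Fintype.card_prod, ← Fintype.card_prod, ← Finset.card_univ]
  symm
  refine Finset.card_bij (fun p _ => p.1.1.skewProd p.1.2 p.2) ?_ ?_ ?_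
  · rintro ⟨⟨g, h⟩, c⟩ _
    simp only [mem_filter, mem_univ, true_and]
    intro i
    rw [Subsingleton.elim i 0]
    exact (smul_baseTriple_zero_iff _).2 fun y => by simp
  · rintro ⟨⟨g, h⟩, c⟩ _ ⟨⟨g', h'⟩, c'⟩ _ he
    obtain ⟨rfl, rfl, rfl⟩ := skewProd_inj he
    rfl
  · intro φ hφ
    simp only [mem_filter, mem_univ, true_and] at hφ
    obtain ⟨g, h, c, rfl⟩ := exists_eq_skewProd φ ((smul_baseTriple_zero_iff _).1 (hφ 0))
    exact ⟨⟨⟨g, h⟩, c⟩, mem_univ _, rfl⟩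

theorem card_stabilizer_two :
    #{φ : (K × K) ≃ₗ[F] (K × K) | ∀ i : Fin 2,
      φ • spreadElement F K ((Fin.castLEEmb (by decide : 2 ≤ 3)).trans (baseTriple K) i) =
        spreadElement F K ((Fin.castLEEmb (by decide : 2 ≤ 3)).trans (baseTriple K) i)} =
      Fintype.card (K ≃ₗ[F] K) ^ 2 := by
  rw [sq, ← Fintype.card_prod, ← Finset.card_univ]
  symm
  refine Finset.card_bij (fun p _ => p.1.skewProd p.2 0) ?_ ?_ ?_
  · rintro ⟨g, h⟩ _
    simp only [mem_filter, mem_univ, true_and, Fin.forall_fin_two]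
    exact ⟨(smul_baseTriple_zero_iff _).2 fun y => by simp,
      (smul_baseTriple_one_iff _).2 fun y => by simp⟩
  · rintro ⟨g, h⟩ _ ⟨g', h'⟩ _ he
    obtain ⟨rfl, rfl, -⟩ := skewProd_inj he
    rfl
  · intro φ hφ
    simp only [mem_filter, mem_univ, true_and] at hφ
    obtain ⟨g, h, c, rfl⟩ := exists_eq_skewProd φ ((smul_baseTriple_zero_iff _).1 (hφ 0))
    have h1 := (smul_baseTriple_one_iff _).1 (hφ 1)
    have hc : c = 0 := by ext x; simpa using h1 x
    exact ⟨⟨g, h⟩, mem_univ _, by rw [hc]⟩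

theorem sum_stabilizer_three (f : ((K × K) ≃ₗ[F] (K × K)) → ℚ) :
    ∑ φ : (K × K) ≃ₗ[F] (K × K) with ∀ i : Fin 3,
      φ • spreadElement F K (baseTriple K i) = spreadElement F K (baseTriple K i), f φ =
      ∑ g : K ≃ₗ[F] K, f (g.skewProd g 0) := by
  symm
  refine Finset.sum_bij (fun g _ => g.skewProd g 0) ?_ ?_ ?_ (fun _ _ => rfl)
  · rintro g _
    simp only [mem_filter, mem_univ, true_and, Fin.forall_fin_succ, Fin.forall_fin_zero,
      and_true]
    exact ⟨(smul_baseTriple_zero_iff _).2 fun y => by simp,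
      (smul_baseTriple_one_iff _).2 fun y => by simp,
      (smul_baseTriple_two_iff _).2 fun y => by simp⟩
  · rintro g _ g' _ he
    exact (skewProd_inj he).1
  · intro φ hφ
    simp only [mem_filter, mem_univ, true_and] at hφ
    obtain ⟨g, h, c, rfl⟩ := exists_eq_skewProd φ ((smul_baseTriple_zero_iff _).1 (hφ 0))
    have h1 := (smul_baseTriple_one_iff _).1 (hφ 1)
    have h2 := (smul_baseTriple_two_iff _).1 (hφ 2)
    have hc : c = 0 := by ext x; simpa using h1 x
    subst hc
    have hg : g = h := by ext x; simpa using h2 x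
    exact ⟨g, mem_univ _, by rw [hg]⟩

end Stabilizer

/-! ### Semilinear groups and the degree of the intertwining field -/

section Semilinear

theorem card_linearEquiv {E M : Type*} [Field E] [AddCommGroup M] [Module E M]
    [FiniteDimensional E M] {d : ℕ} (hd : Module.finrank E M = d) :
    Nat.card (M ≃ₗ[E] M) = cardGL d E := by
  have e : M ≃ₗ[E] (Fin d → E) := LinearEquiv.ofFinrankEq _ _ (by simp [hd])
  have e' : (M ≃ₗ[E] M) ≃ ((Fin d → E) ≃ₗ[E] (Fin d → E)) :=
    { toFun := fun f => e.symm ≪≫ₗ f ≪≫ₗ e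
      invFun := fun f => e ≪≫ₗ f ≪≫ₗ e.symm
      left_inv := fun f => by ext; simp
      right_inv := fun f => by ext; simp }
  rw [cardGL, Nat.card_congr e']
  exact Nat.card_congr ((Matrix.GeneralLinearGroup.toLin (n := Fin d) (R := E)).trans
    (LinearMap.GeneralLinearGroup.generalLinearEquiv E (Fin d → E))).symm.toEquiv

/-- Normality of `K` extends each automorphism of `E` to `K`. Composing the extension with the
`E`-linear bijections gives every semilinear map with that companion, and the companion is
determined by the map. -/
theorem card_semilinearGroup {F K : Type*} [Field F] [Field K] [Algebra F K]
    [FiniteDimensional F K] [Normal F K] (E : IntermediateField F K) [IsGalois F E] :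
    Nat.card (semilinearGroup F K E) = Module.finrank F E * Nat.card (K ≃ₗ[E] K) := by
  have hlift : ∀ σ : E ≃ₐ[F] E, ∃ τ : K ≃ₐ[F] K, ∀ v : E, τ (v : K) = (σ v : K) := by
    intro σ
    obtain ⟨τ, rfl⟩ := AlgEquiv.restrictNormalHom_surjective K σ
    exact ⟨τ, fun v => (AlgEquiv.restrictNormal_commutes τ E v).symm⟩
  choose lift hl using hlift
  rw [← IsGalois.card_aut_eq_finrank, ← Nat.card_prod]
  symm
  have hsemi : ∀ (p : (E ≃ₐ[F] E) × (K ≃ₗ[E] K)) (v : E) (x : K),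
      lift p.1 (p.2 ((v : K) * x)) = (p.1 v : K) * lift p.1 (p.2 x) := by
    rintro ⟨σ, h⟩ v x
    have : h ((v : K) * x) = v * h x := h.map_smul v x
    rw [this, map_mul, hl]
  refine Nat.card_eq_of_bijective (fun p : (E ≃ₐ[F] E) × (K ≃ₗ[E] K) =>
    (⟨p.2.restrictScalars F ≪≫ₗ (lift p.1).toLinearEquiv, p.1, hsemi p⟩ :
      semilinearGroup F K E)) ⟨?_, ?_⟩
  · rintro p p' h
    have hx : ∀ x, lift p.1 (p.2 x) = lift p'.1 (p'.2 x) := fun x =>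
      congrArg (fun φ : K ≃ₗ[F] K => φ x) (congrArg Subtype.val h)
    have h1 : p.1 = p'.1 := by
      ext v
      have h2 := hx ((v : K) * 1)
      rw [hsemi, hsemi, ← hx 1] at h2
      exact mul_right_cancel₀ (by simp) h2
    refine Prod.ext h1 ?_
    ext x
    have := hx x
    rw [h1] at this
    exact (lift p'.1).injective this
  · rintro ⟨φ, σ, hσ⟩
    have hs : ∀ (v : E) (x : K), (lift σ).symm (φ ((v : K) * x)) = v * (lift σ).symm (φ x) := by
      intro v x
      apply (lift σ).injective
      rw [AlgEquiv.apply_symm_apply, hσ, map_mul (lift σ), hl, AlgEquiv.apply_symm_apply]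
    refine ⟨(σ, { (φ.toEquiv.trans (lift σ).symm.toEquiv) with
      map_add' := fun x y => by simp
      map_smul' := fun v x => hs v x }), Subtype.ext ?_⟩
    ext x
    exact (lift σ).apply_symm_apply (φ x)

variable {F K : Type*} [Field F] [Fintype F] [Field K] [Algebra F K] [FiniteDimensional F K]

theorem eq_subfieldOfDegree (E : IntermediateField F K) :
    E = subfieldOfDegree F K (Module.finrank F E) := by
  have : Finite K := Module.finite_of_finite F
  have : Fintype E := Fintype.ofFinite E
  refine IntermediateField.eq_of_le_of_finrank_eq ?_ ?_
  · intro x hx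
    rw [mem_subfieldOfDegree, ← Module.card_eq_pow_finrank]
    exact congrArg Subtype.val (FiniteField.pow_card (⟨x, hx⟩ : E))
  · rw [finrank_subfieldOfDegree]
    exact ⟨_, (Module.finrank_mul_finrank F E K).symm⟩

theorem subfieldOfDegree_le_iff {m : ℕ} (hm : m ∣ Module.finrank F K) (E : IntermediateField F K) :
    subfieldOfDegree F K m ≤ E ↔ m ∣ Module.finrank F E := by
  constructor
  · intro h
    rw [← finrank_subfieldOfDegree F K m hm]
    exact IntermediateField.finrank_dvd_of_le_right h
  · rintro ⟨t, ht⟩ x hx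
    rw [eq_subfieldOfDegree E, mem_subfieldOfDegree, ht, pow_mul]
    rw [mem_subfieldOfDegree] at hx
    generalize Fintype.card F ^ m = r at hx
    clear ht
    induction t with
    | zero => simp
    | succ t ih => rw [pow_succ, pow_mul, ih, hx]

/-- By `subfieldOfDegree_le_iff` the divisibility says that the subfield lies in the intertwining
field. The multiplier attached to each scalar is then automatically an automorphism: it is
determined by the value at `1`, hence is an `F`-algebra map, and it preserves the equation `x ^ (q ^
m) = x` defining the subfield. -/
theorem mem_semilinearGroup_iff {m : ℕ} (hm : m ∣ Module.finrank F K) (g : K ≃ₗ[F] K) :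
    g ∈ semilinearGroup F K (subfieldOfDegree F K m) ↔
      m ∣ Module.finrank F (intertwiningField g) := by
  rw [← subfieldOfDegree_le_iff hm]
  have hg1 : g 1 ≠ 0 := by simp
  constructor
  · rintro ⟨σ, hσ⟩ v hv
    exact ⟨σ ⟨v, hv⟩, fun x => hσ ⟨v, hv⟩ x⟩
  · intro h
    have hc : ∀ v : subfieldOfDegree F K m, ∃ b : K, ∀ x, g (v * x) = b * g x := fun v => h v.2
    choose τ hτ using hc
    have huniq : ∀ (v : subfieldOfDegree F K m) (b : K), g (v * 1) = b * g 1 → τ v = b :=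
      fun v b hb => mul_right_cancel₀ hg1 ((hτ v 1).symm.trans hb)
    let τ' : subfieldOfDegree F K m →ₐ[F] K :=
      { toFun := τ
        map_one' := huniq _ _ (by simp)
        map_mul' := fun v w => huniq _ _ (by
          rw [mul_assoc, ← hτ w, ← hτ v, ← mul_assoc]; rfl)
        map_zero' := huniq _ _ (by simp)
        map_add' := fun v w => huniq _ _ (by
          rw [add_mul, ← hτ w, ← hτ v, ← map_add, ← add_mul]; rfl)
        commutes' := fun r => huniq _ _ (by
          change g (algebraMap F K r * 1) = _
          rw [← Algebra.smul_def, map_smul, Algebra.smul_def]) }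
    have hmem : ∀ v, τ' v ∈ subfieldOfDegree F K m := by
      intro v
      have := v.2
      rw [mem_subfieldOfDegree] at this ⊢
      rw [← map_pow]
      exact congrArg τ' (Subtype.ext this)
    let σ : subfieldOfDegree F K m →ₐ[F] subfieldOfDegree F K m :=
      τ'.codRestrict (subfieldOfDegree F K m).toSubalgebra hmem
    exact ⟨AlgEquiv.ofBijective σ (Algebra.IsAlgebraic.algHom_bijective σ), fun v x => hτ v x⟩

/-- The semilinear group of degree `l` consists of the `g` whose field has degree divisible by `l`.
It splits into degree exactly `l` and the union over proper multiples of `l`. -/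
theorem card_filter_finrank_intertwiningField [Fintype (K ≃ₗ[F] K)] {l : ℕ}
    (hl : l ∣ Module.finrank F K) :
    (Finset.card {g : K ≃ₗ[F] K | Module.finrank F (intertwiningField g) = l}) +
        unionCard F K (Module.finrank F K) l =
      l * cardGL (Module.finrank F K / l) (subfieldOfDegree F K l) := by
  classical
  have hK : Finite K := Module.finite_of_finite F
  have hf : Module.finrank (subfieldOfDegree F K l) K = Module.finrank F K / l := by
    have h := Module.finrank_mul_finrank F (subfieldOfDegree F K l) K
    rw [finrank_subfieldOfDegree F K l hl] at h
    have : 0 < l := Nat.pos_of_dvd_of_pos hl Module.finrank_pos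
    rw [← h, Nat.mul_div_cancel_left _ this]
  have hd : ∀ g : K ≃ₗ[F] K, Module.finrank F (intertwiningField g) ∣ Module.finrank F K :=
    fun g => ⟨_, (Module.finrank_mul_finrank F (intertwiningField g) K).symm⟩
  have h1 := card_semilinearGroup (subfieldOfDegree F K l)
  rw [finrank_subfieldOfDegree F K l hl, card_linearEquiv hf] at h1
  rw [← h1, unionCard, ← Set.ncard_coe_finset, ← Set.ncard_union_eq]
  · rw [← Nat.card_coe_set_eq]
    congr 2
    ext g
    simp only [Finset.coe_filter, Finset.mem_univ, true_and, Set.mem_union, Set.mem_ofPred_eq,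
      Set.mem_iUnion, SetLike.mem_coe, exists_prop]
    rw [mem_semilinearGroup_iff hl]
    constructor
    · rintro (rfl | ⟨m, ⟨hm, hlm, -⟩, hg⟩)
      · rfl
      · exact hlm.trans ((mem_semilinearGroup_iff hm g).1 hg)
    · intro h
      by_cases he : Module.finrank F (intertwiningField g) = l
      · exact Or.inl he
      · exact Or.inr ⟨_, ⟨hd g, h, he⟩, (mem_semilinearGroup_iff (hd g) g).2 dvd_rfl⟩
  · rw [Set.disjoint_left]
    intro g hg hg'
    simp only [Finset.coe_filter, Finset.mem_univ, true_and, Set.mem_ofPred_eq] at hg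
    simp only [Set.mem_ofPred_eq, Set.mem_iUnion, SetLike.mem_coe, exists_prop] at hg'
    obtain ⟨m, ⟨hm, hlm, hne⟩, hg'⟩ := hg'
    rw [mem_semilinearGroup_iff hm, hg] at hg'
    exact hne (Nat.dvd_antisymm hg' hlm)

theorem sum_finrank_intertwiningField [Fintype (K ≃ₗ[F] K)] (f : ℕ → ℚ) :
    ∑ g : K ≃ₗ[F] K, f (Module.finrank F (intertwiningField g)) =
      ∑ l ∈ Nat.divisors (Module.finrank F K),
        ((l : ℚ) * cardGL (Module.finrank F K / l) (subfieldOfDegree F K l) -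
          unionCard F K (Module.finrank F K) l) * f l := by
  classical
  have hmaps : ∀ g ∈ (Finset.univ : Finset (K ≃ₗ[F] K)),
      Module.finrank F (intertwiningField g) ∈ Nat.divisors (Module.finrank F K) := fun g _ =>
    Nat.mem_divisors.2 ⟨⟨_, (Module.finrank_mul_finrank F (intertwiningField g) K).symm⟩,
      Module.finrank_pos.ne'⟩
  rw [← Finset.sum_fiberwise_of_maps_to hmaps]
  refine Finset.sum_congr rfl fun l hl => ?_
  have h := card_filter_finrank_intertwiningField (F := F) (K := K) (Nat.dvd_of_mem_divisors hl)
  have h' : ((Finset.card {g : K ≃ₗ[F] K | Module.finrank F (intertwiningField g) = l} : ℕ) : ℚ) =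
      (l : ℚ) * cardGL (Module.finrank F K / l) (subfieldOfDegree F K l) -
        unionCard F K (Module.finrank F K) l := by
    rw [eq_sub_iff_add_eq]; exact_mod_cast h
  rw [← h', ← nsmul_eq_mul]
  exact Finset.sum_eq_card_nsmul fun g hg => by rw [(Finset.mem_filter.1 hg).2]

end Semilinear

/-! ### The exact count, comparison with `L`, and the greedy bound -/

section Bound

open scoped LinearAlgebra.Projectivization Pointwise
open Projectivization Finset

instance finite_linearEquiv {F M : Type*} [Field F] [AddCommGroup M] [Module F M] [Finite M] :
    Finite (M ≃ₗ[F] M) :=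
  DFunLike.finite _

theorem IsSpread.map {F V V' : Type*} [Field F] [AddCommGroup V] [Module F V] [AddCommGroup V'] [Module F V']
    {k : ℕ} {S : Set (Submodule F V)} (hS : IsSpread F V k S) (e : V ≃ₗ[F] V') :
    IsSpread F V' k (Submodule.map e.toLinearMap '' S) := by
  constructor
  · rintro _ ⟨U, hU, rfl⟩
    rw [← hS.1 U hU]
    exact LinearEquiv.finrank_map_eq e U
  · intro v hv
    obtain ⟨U, ⟨hU, hvU⟩, huniq⟩ := hS.2 (e.symm v) (by simpa using hv)
    refine ⟨U.map e.toLinearMap, ⟨⟨U, hU, rfl⟩, ⟨_, hvU, by simp⟩⟩, ?_⟩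
    rintro _ ⟨⟨U', hU', rfl⟩, ⟨w, hw, hwv⟩⟩
    rw [huniq U' ⟨hU', ?_⟩]
    rw [← hwv]
    simpa using hw

theorem ncard_le_maxPartialParallelism {F V : Type*} [Field F] [AddCommGroup V] [Module F V] [Finite V]
    {k : ℕ} {P : Set (Set (Submodule F V))} (hP : IsPartialParallelism F V k P) :
    P.ncard ≤ maxPartialParallelism F V k := by
  refine le_csSup ⟨Nat.card (Set (Submodule F V)), ?_⟩ ⟨P, hP, rfl⟩
  rintro _ ⟨P', -, rfl⟩
  exact Set.ncard_le_card P'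

variable {F K : Type*} [Field F] [Fintype F] [Field K] [Algebra F K] [FiniteDimensional F K]

theorem two_le_card_pow (F : Type*) [Field F] [Fintype F] {l : ℕ} (hl : 0 < l) :
    2 ≤ Fintype.card F ^ l :=
  (Fintype.one_lt_card (α := F)).trans_le (Nat.le_self_pow hl.ne' _)

theorem spreadSize_eq (q k : ℕ) (h : 2 ≤ q ^ k) : spreadSize q k = q ^ k + 1 := by
  have : q ^ (2 * k) - 1 = (q ^ k + 1) * (q ^ k - 1) := by
    rw [mul_comm 2 k, pow_mul, sq]
    obtain ⟨t, ht⟩ := Nat.exists_eq_add_of_le h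
    rw [ht, show 2 + t - 1 = 1 + t by omega,
      show (2 + t) * (2 + t) = (2 + t + 1) * (1 + t) + 1 by ring, Nat.add_sub_cancel]
  rw [spreadSize, this, Nat.mul_div_cancel _ (by omega)]

theorem card_projectivization_prod [Finite K] :
    Nat.card (ℙ K (K × K)) = spreadSize (Fintype.card F) (Module.finrank F K) := by
  have : Fintype K := Fintype.ofFinite K
  rw [card_of_finrank_two K _ (by simp), Nat.card_eq_fintype_card,
    Module.card_eq_pow_finrank (K := F),
    spreadSize_eq _ _ (two_le_card_pow F Module.finrank_pos)]

/-- The number of elements of the linear group of `K × K` for which the Desarguesian spread and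
its image meet, in closed form. -/
theorem card_filter_hitCount [Fintype ((K × K) ≃ₗ[F] (K × K))] {q k N : ℕ}
    (hq : Fintype.card F = q) (hk : Module.finrank F K = k) (hN : spreadSize q k = N) :
    (#{φ : (K × K) ≃ₗ[F] (K × K) | 1 ≤ hitCount (spreadElement F K) φ} : ℚ) =
      (N : ℚ) ^ 2 * (q : ℚ) ^ (k ^ 2) * (cardGL k F : ℚ) ^ 2
        - 1 / 2 * ((N : ℚ) * (N - 1)) ^ 2 * (cardGL k F : ℚ) ^ 2
        + 1 / (Nat.factorial 3 : ℚ) * ((N : ℚ) * (N - 1) * (N - 2)) ^ 2 * (cardGL k F : ℚ)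
        + ((N : ℚ) * (N - 1) * (N - 2)) ^ 2 * ∑ l ∈ Nat.divisors k,
          ((l : ℚ) * cardGL (k / l) (subfieldOfDegree F K l) - unionCard F K k l) *
            tailCoeff N (q ^ l + 1) := by
  classical
  subst hk hq
  set q := Fintype.card F
  set k := Module.finrank F K with hk
  have hKf : Finite K := Module.finite_of_finite F
  have : Fintype K := Fintype.ofFinite K
  have : Fintype (K ≃ₗ[F] K) := Fintype.ofFinite _
  have : Finite (K →ₗ[F] K) := DFunLike.finite _
  have : Fintype (K →ₗ[F] K) := Fintype.ofFinite _
  have : Fintype (ℙ K (K × K)) := Fintype.ofFinite _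
  have hX : Nat.card (ℙ K (K × K)) = N := (card_projectivization_prod (F := F)).trans hN
  have hX' : Fintype.card (ℙ K (K × K)) = N := by rw [← hX, Nat.card_eq_fintype_card]
  have hN3 : 3 ≤ N := by
    have := two_le_card_pow F (l := k) Module.finrank_pos
    rw [← hN, spreadSize_eq _ _ this]; omega
  have h3 : MulAction.IsMultiplyPretransitive ((K × K) ≃ₗ[K] (K × K)) (ℙ K (K × K)) 3 :=
    isMultiplyPretransitive_three (by simp)
  have h2 : MulAction.IsMultiplyPretransitive ((K × K) ≃ₗ[K] (K × K)) (ℙ K (K × K)) 2 :=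
    MulAction.isMultiplyPretransitive_of_le (n := 3) (by norm_num) (by omega)
  have h1 : MulAction.IsMultiplyPretransitive ((K × K) ≃ₗ[K] (K × K)) (ℙ K (K × K)) 1 :=
    MulAction.isMultiplyPretransitive_of_le (n := 3) (by norm_num) (by omega)
  have hGL : Fintype.card (K ≃ₗ[F] K) = cardGL k F := by
    rw [← Nat.card_eq_fintype_card, card_linearEquiv hk.symm]
  have hEnd : Fintype.card (K →ₗ[F] K) = q ^ (k ^ 2) := by
    rw [Module.card_eq_pow_finrank (K := F), Module.finrank_linearMap, ← sq]
  have hinj := spreadElement_injective F K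
  have hsmul := spreadElement_smul (F := F) (K := K)
  have e1 := sum_descFactorial_hitCount (restrictScalarsHom F K) hinj hsmul 1 h1
    ((Fin.castLEEmb (by decide : 1 ≤ 3)).trans (baseTriple K)) (fun _ => 1)
  have e2 := sum_descFactorial_hitCount (restrictScalarsHom F K) hinj hsmul 2 h2
    ((Fin.castLEEmb (by decide : 2 ≤ 3)).trans (baseTriple K)) (fun _ => 1)
  have e3 := fun f => sum_descFactorial_hitCount (restrictScalarsHom F K) hinj hsmul 3 h3
    (baseTriple K) f
  rw [sum_const, card_stabilizer_one, hGL, hEnd, hX'] at e1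
  rw [sum_const, card_stabilizer_two, hGL, hX'] at e2
  simp only [sum_stabilizer_three, hX'] at e3
  have e3a := e3 (fun _ => 1)
  have e3b := e3 (tailCoeff N)
  rw [sum_const, Finset.card_univ, hGL] at e3a
  have hE : ∀ g : K ≃ₗ[F] K, hitCount (spreadElement F K)
      (g.skewProd g 0 : (K × K) ≃ₗ[F] (K × K)) =
        q ^ Module.finrank F (intertwiningField g) + 1 := by
    intro g
    have : Fintype (intertwiningField g) := Fintype.ofFinite _
    rw [hitCount_skewProd_self, Nat.card_eq_fintype_card, Module.card_eq_pow_finrank (K := F)]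
  simp only [hE] at e3b
  rw [sum_finrank_intertwiningField (F := F) (K := K) (fun l => tailCoeff N (q ^ l + 1))] at e3b
  have hd1 : (N.descFactorial 1 : ℚ) = N := by simp
  have hd2 : (N.descFactorial 2 : ℚ) = N * (N - 1) := by
    obtain ⟨t, rfl⟩ := Nat.exists_eq_add_of_le' hN3
    simp [Nat.descFactorial_succ]; ring
  have hd3 : (N.descFactorial 3 : ℚ) = N * (N - 1) * (N - 2) := by
    obtain ⟨t, rfl⟩ := Nat.exists_eq_add_of_le' hN3
    simp [Nat.descFactorial_succ]; ring
  -- Inclusion-exclusion needs `s ≥ 1`; at `s = 0` every falling factorial on the right vanishes.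
  have hpt : ∀ φ : (K × K) ≃ₗ[F] (K × K),
      (if 1 ≤ hitCount (spreadElement F K) φ then 1 else 0 : ℚ) =
        ((hitCount (spreadElement F K) φ).descFactorial 1 : ℚ) * 1
        - 1 / 2 * (((hitCount (spreadElement F K) φ).descFactorial 2 : ℚ) * 1)
        + 1 / (Nat.factorial 3 : ℚ) * (((hitCount (spreadElement F K) φ).descFactorial 3 : ℚ) * 1)
        + ((hitCount (spreadElement F K) φ).descFactorial 3 : ℚ) *
          tailCoeff N (hitCount (spreadElement F K) φ) := by
    intro φ
    split_ifs with h
    · rw [Nat.descFactorial_one, mul_one, mul_one, mul_one]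
      exact (inclusion_exclusion N _ h ((hitCount_le φ).trans_eq hX) hN3).symm
    · have h0 : hitCount (spreadElement F K) φ = 0 := by omega
      simp [h0]
  rw [Finset.card_filter]
  push_cast
  rw [Finset.sum_congr rfl fun φ _ => hpt φ, sum_add_distrib, sum_add_distrib, sum_sub_distrib,
    ← Finset.mul_sum, ← Finset.mul_sum, e1, e2, e3a, e3b, hd1, hd2, hd3]
  simp only [nsmul_eq_mul]
  push_cast
  ring

/-- After exchanging the sums over `i` and `l`, `L` differs from the exact count only in having `l
(|GL| - U)` where the count has `l |GL| - U`, with `U` the size of the union. The former is no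
larger as `l ≥ 1`, and it multiplies a nonpositive tail coefficient. -/
theorem card_filter_hitCount_le_L [Fintype ((K × K) ≃ₗ[F] (K × K))] {q k : ℕ}
    (hq : Fintype.card F = q) (hk : Module.finrank F K = k) :
    (#{φ : (K × K) ≃ₗ[F] (K × K) | 1 ≤ hitCount (spreadElement F K) φ} : ℚ) ≤ L F K q k := by
  have hk0 : 0 < k := hk ▸ Module.finrank_pos
  have hN : spreadSize q k = q ^ k + 1 := spreadSize_eq _ _ (hq ▸ two_le_card_pow F hk0)
  rw [card_filter_hitCount hq hk rfl, L]
  set N := spreadSize q k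
  set T : ℚ := ((N : ℚ) * (N - 1) * (N - 2)) ^ 2 with hT
  have hsum : ∑ i ∈ Finset.Icc 4 N,
        (-1 : ℚ) ^ (i + 1) * (1 / (Nat.factorial i : ℚ)) * T *
          ∑ l ∈ Nat.divisors k,
            ((cardGL (k / l) (subfieldOfDegree F K l) : ℚ) - (unionCard F K k l : ℚ)) * (l : ℚ) *
              (Nat.descFactorial (q ^ l - 2) (i - 3) : ℚ) =
      T * ∑ l ∈ Nat.divisors k,
        ((cardGL (k / l) (subfieldOfDegree F K l) : ℚ) - (unionCard F K k l : ℚ)) * (l : ℚ) *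
          tailCoeff N (q ^ l + 1) := by
    simp only [tailCoeff, Finset.mul_sum]
    rw [Finset.sum_comm]
    refine Finset.sum_congr rfl fun l _ => Finset.sum_congr rfl fun i _ => ?_
    rw [show q ^ l + 1 - 3 = q ^ l - 2 by omega]
    ring
  rw [hsum]
  refine add_le_add le_rfl (mul_le_mul_of_nonneg_left ?_ (sq_nonneg _))
  refine Finset.sum_le_sum fun l hl => ?_
  have hl0 : 0 < l := Nat.pos_of_mem_divisors hl
  have hlk : l ≤ k := Nat.divisor_le hl
  have h2 : 2 ≤ q ^ l := hq ▸ two_le_card_pow F hl0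
  have hqpos : 0 < q := hq ▸ Fintype.card_pos
  have ht : tailCoeff N (q ^ l + 1) ≤ 0 := tailCoeff_nonpos _ _ (by omega) (by
    rw [hN]; have := Nat.pow_le_pow_right hqpos hlk; omega)
  refine mul_le_mul_of_nonpos_right ?_ ht
  have hl1 : (1 : ℚ) ≤ l := by exact_mod_cast hl0
  have hU : (0 : ℚ) ≤ unionCard F K k l := by positivity
  nlinarith

/-- A greedy choice of images of the Desarguesian spread. -/
theorem card_le_maxPartialParallelism_mul [Fintype ((K × K) ≃ₗ[F] (K × K))]
    {V : Type*} [AddCommGroup V] [Module F V] (e : (K × K) ≃ₗ[F] V) :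
    Fintype.card ((K × K) ≃ₗ[F] (K × K)) ≤ maxPartialParallelism F V (Module.finrank F K) *
      #{φ : (K × K) ≃ₗ[F] (K × K) | 1 ≤ hitCount (spreadElement F K) φ} := by
  classical
  have hKf : Finite K := Module.finite_of_finite F
  have hVf : Finite V := Finite.of_equiv _ e.toEquiv
  let T : ((K × K) ≃ₗ[F] (K × K)) → Set (Submodule F V) := fun φ =>
    Submodule.map (φ ≪≫ₗ e).toLinearMap '' Set.range (spreadElement F K)
  have hT : ∀ φ, IsSpread F V (Module.finrank F K) (T φ) := fun φ =>
    isSpread_spreadElement.map _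
  have hmeet : ∀ φ ψ, ¬ Disjoint (T φ) (T ψ) →
      1 ≤ hitCount (spreadElement F K) (ψ⁻¹ * φ) := by
    intro φ ψ h
    obtain ⟨_, ⟨_, ⟨p, rfl⟩, h1⟩, ⟨_, ⟨p', rfl⟩, h2⟩⟩ := Set.not_disjoint_iff.1 h
    have h3 : (φ • spreadElement F K p).map e.toLinearMap =
        (ψ • spreadElement F K p').map e.toLinearMap := by
      have := h1.trans h2.symm
      rw [LinearEquiv.coe_trans, LinearEquiv.coe_trans, Submodule.map_comp,
        Submodule.map_comp] at this
      exact this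
    have h4 := Submodule.map_injective_of_injective e.injective h3
    have : Nonempty {p : ℙ K (K × K) // ∃ p',
        (ψ⁻¹ * φ) • spreadElement F K p = spreadElement F K p'} :=
      ⟨p, p', by rw [mul_smul, h4, inv_smul_smul]⟩
    exact Nat.card_pos
  obtain ⟨Φ, hΦ, hmax⟩ := Finset.exists_max_image
    ({Φ : Finset ((K × K) ≃ₗ[F] (K × K)) |
      (Φ : Set ((K × K) ≃ₗ[F] (K × K))).Pairwise fun φ ψ => Disjoint (T φ) (T ψ)} : Finset _)
    Finset.card ⟨∅, by simp⟩
  rw [mem_filter] at hΦ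
  -- Nonempty spreads are not disjoint from themselves, so distinct members of `Φ` give distinct
  -- spreads.
  have hne : ∀ φ, (T φ).Nonempty := fun φ => (Set.range_nonempty _).image _
  have hinj : Set.InjOn T Φ := by
    intro φ hφ ψ hψ h
    by_contra hc
    have : Disjoint (T φ) (T ψ) := hΦ.2 hφ hψ hc
    rw [h, disjoint_self] at this
    exact (hne ψ).ne_empty this
  have hP : IsPartialParallelism F V (Module.finrank F K) (T '' Φ) := by
    constructor
    · rintro _ ⟨φ, -, rfl⟩
      exact hT φ
    · rintro _ ⟨φ, hφ, rfl⟩ _ ⟨ψ, hψ, rfl⟩ h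
      exact hΦ.2 hφ hψ fun h' => h (congrArg T h')
  have hle := ncard_le_maxPartialParallelism hP
  rw [hinj.ncard_image, Set.ncard_coe_finset] at hle
  refine le_trans ?_ (Nat.mul_le_mul_right _ hle)
  -- Maximality of `Φ` covers the group by the translates `ψ B` with `ψ ∈ Φ`, where `B` is the set
  -- of elements with positive `hitCount`.
  have hcover : (univ : Finset ((K × K) ≃ₗ[F] (K × K))) ⊆ Φ.biUnion fun ψ =>
      ({φ : (K × K) ≃ₗ[F] (K × K) | 1 ≤ hitCount (spreadElement F K) φ} : Finset _).image
        (ψ * ·) := by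
    intro φ _
    have : ∃ ψ ∈ Φ, ¬ Disjoint (T φ) (T ψ) := by
      by_cases hφ : φ ∈ Φ
      · exact ⟨φ, hφ, fun h => (hne φ).ne_empty (disjoint_self.1 h)⟩
      · by_contra! hc
        have := hmax (insert φ Φ) (by
          rw [mem_filter, coe_insert]
          exact ⟨mem_univ _, hΦ.2.insert fun ψ hψ _ => ⟨hc ψ hψ, (hc ψ hψ).symm⟩⟩)
        rw [card_insert_of_notMem hφ] at this
        omega
    obtain ⟨ψ, hψ, h⟩ := this
    rw [mem_biUnion]
    exact ⟨ψ, hψ, mem_image.2 ⟨ψ⁻¹ * φ, by simpa using hmeet φ ψ h, by simp⟩⟩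
  rw [← Finset.card_univ]
  exact (card_le_card hcover).trans (card_biUnion_le_card_mul _ _ _ fun ψ _ => card_image_le)

end Bound

end PartialParallelism

end

theorem theorem3p2 {F K V : Type*} [Field F] [Fintype F] [Field K] [Algebra F K]
    [FiniteDimensional F K] [AddCommGroup V] [Module F V] (q k : ℕ) (hk : 0 < k)
    (hF : Fintype.card F = q) (hK : Module.finrank F K = k) (hV : Module.finrank F V = 2 * k) :
    0 < PartialParallelism.L F K q k ∧
      (PartialParallelism.cardGL (2 * k) F : ℚ) / PartialParallelism.L F K q k ≤
        (PartialParallelism.maxPartialParallelism F V k : ℚ) := by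
  open PartialParallelism in
  classical
  have hKf : Finite K := Module.finite_of_finite F
  have : Fintype ((K × K) ≃ₗ[F] (K × K)) := Fintype.ofFinite _
  have : FiniteDimensional F V := Module.finite_of_finrank_pos (by omega)
  have hKK : Module.finrank F (K × K) = 2 * k := by rw [Module.finrank_prod, hK, two_mul]
  have e : (K × K) ≃ₗ[F] V := LinearEquiv.ofFinrankEq _ _ (hKK.trans hV.symm)
  have hL := card_filter_hitCount_le_L hF hK
  have hgreedy := card_le_maxPartialParallelism_mul e
  rw [← Nat.card_eq_fintype_card, card_linearEquiv hKK, hK] at hgreedy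
  have hcard : 0 < cardGL (2 * k) F := by
    rw [← card_linearEquiv hKK]; exact Nat.card_pos
  have hpos : 0 < L F K q k := by
    refine lt_of_lt_of_le ?_ hL
    -- The group is nonempty, so the greedy inequality forces the count bounded by `L` to be
    -- positive.
    exact_mod_cast Nat.pos_of_mul_pos_left (hcard.trans_le hgreedy)
  refine ⟨hpos, ?_⟩
  rw [div_le_iff₀ hpos]
  refine (Nat.cast_le (α := ℚ).2 hgreedy).trans ?_
  rw [Nat.cast_mul]
  gcongr
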